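/- For positive integers $g,n$ let $N=2gn$, let $|D^N_w\rangle=\binom Nw^{-1/2}\sum_{x\in\{0,1\}^N,\,x_1+\dots+x_N=w}|x\rangle$ be the Dicke states of $N$ qubits, and let $$|\varphi_2\rangle=2^{-n/2}\sum_{j=0}^n\sqrt{\tbinom nj}\,|D^{N}_{gj}\rangle .$$ On $N$ qubits let $Z_j$ be the Pauli $Z$ operator on qubit $j$, let $H=\sum_{j=1}^N Z_j$, and for $\lambda\in[0,1]$ let $$\mathcal D_\lambda(\rho)=\lambda\rho+\frac{1-\lambda}{N}\sum_{j=1}^N Z_j\rho Z_j .$$ For a state $\rho=\sum_a p_a|a\rangle\langle a|$ in spectral decomposition, the quantum Fisher information (QFI) with respect to the generator $H$ is $$F(\rho)=2\sum_{a,b:\,p_a+p_b>0}\frac{(p_a-p_b)^2}{p_a+p_b}\,|\langle a|H|b\rangle|^2 .$$ 1. For every integer $n\ge1$ and every $\lambda\in[0,1]$, for all sufficiently large $g$ (depending on $n$ and $\lambda$), $$\frac{F\big(\mathcal D_\lambda(|\varphi_2\rangle\langle\varphi_2|)\big)}{N^2}\;\ge\;\frac{\lambda^2}{2n}+\lambda(1-\lambda)\frac{n-1}{4n^2}+(1-\lambda)^2\frac{n^3+n-2}{32n^4}.$$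 2. In particular, Heisenberg scaling holds at $\lambda=\frac12$: for every $n\ge 1$ the constant $$c_n=\frac{25}{128n}-\frac1{16n^2}+\frac1{128n^3}-\frac1{64n^4}$$ is positive, and $F\big(\mathcal D_{1/2}(|\varphi_2\rangle\langle\varphi_2|)\big)\ge c_nN^2$ for all sufficiently large $g$. 3. In contrast, for every $N\ge1$, the GHZ state $|\mathrm{GHZ}\rangle=(|0\cdots0\rangle+|1\cdots1\rangle)/\sqrt2$ on $N$ qubits satisfies $$\mathcal D_{1/2}(|\mathrm{GHZ}\rangle\langle\mathrm{GHZ}|)=\tfrac12\big(|0\cdots0\rangle\langle0\cdots0|+|1\cdots1\rangle\langle1\cdots1|\big),$$ and its QFI is $F\big(\mathcal D_{1/2}(|\mathrm{GHZ}\rangle\langle\mathrm{GHZ}|)\big)=0$. -/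

import Mathlib

noncomputable section

namespace Metrology

open Matrix

/-- Labels `x = (x₁, …, x_N) ∈ {0,1}^N` of the computational basis of `N` qubits. -/
abbrev Bits (N : ℕ) : Type := Fin N → Fin 2

/-- State vectors of `N` qubits, by their coordinates in the computational basis. -/
abbrev Ket (N : ℕ) : Type := Bits N → ℂ

/-- Operators on `N` qubits, by their matrices in the computational basis. -/
abbrev Op (N : ℕ) : Type := Matrix (Bits N) (Bits N) ℂ

/-- The Hamming weight `x₁ + … + x_N`. -/
def weight {N : ℕ} (x : Bits N) : ℕ := ∑ j, (x j : ℕ)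

/-- The Pauli operator that applies `Z` on qubit `j` and the identity on all other qubits:
`|x⟩ ↦ (-1)^{x_j} |x⟩`. -/
def pauliZ {N : ℕ} (j : Fin N) : Op N := Matrix.diagonal fun x => (-1 : ℂ) ^ (x j : ℕ)

/-- The generator `H = Z_1 + … + Z_N`. -/
def generator (N : ℕ) : Op N := ∑ j, pauliZ j

/-- The computational basis vector `|x⟩ = |x₁⟩ ⊗ … ⊗ |x_N⟩`. -/
def basisKet {N : ℕ} (x : Bits N) : Ket N := Pi.single x 1

/-- The Dicke state `|D^N_w⟩`. -/
def dicke (N w : ℕ) : Ket N :=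
  ((1 / √(N.choose w : ℝ) : ℝ) : ℂ) • ∑ x : Bits N with weight x = w, basisKet x

/-- The gnu probe state `|φ_u⟩` on `N = g n u` qubits. -/
def gnuProbe (g n u : ℕ) : Ket (g * n * u) :=
  ((√((2 : ℝ) ^ n)⁻¹ : ℝ) : ℂ) •
    ∑ j ∈ Finset.range (n + 1), ((√(n.choose j : ℝ) : ℝ) : ℂ) • dicke (g * n * u) (g * j)

/-- The GHZ state `(|0…0⟩ + |1…1⟩) / √2`. -/
def ghz (N : ℕ) : Ket N :=
  ((1 / √2 : ℝ) : ℂ) • (basisKet (fun _ => 0) + basisKet (fun _ => 1))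

/-- The rank-one operator `|ψ⟩⟨ψ|`. -/
def proj {N : ℕ} (ψ : Ket N) : Op N := Matrix.vecMulVec ψ (star ψ)

/-- The dephasing channel `D_l(ρ) = l ρ + ((1 - l) / N) ∑_j Z_j ρ Z_j`. -/
def dephase {N : ℕ} (l : ℝ) (ρ : Op N) : Op N :=
  (l : ℂ) • ρ + (((1 - l) / N : ℝ) : ℂ) • ∑ j : Fin N, pauliZ j * ρ * pauliZ j

theorem proj_isHermitian {N : ℕ} (ψ : Ket N) : (proj ψ).IsHermitian := by
  ext x y
  simp [proj, Matrix.vecMulVec_apply, mul_comm]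

theorem pauliZ_isHermitian {N : ℕ} (j : Fin N) : (pauliZ j).IsHermitian := by
  apply Matrix.isHermitian_diagonal_of_self_adjoint
  ext x
  simp

theorem dephase_isHermitian {N : ℕ} (l : ℝ) {ρ : Op N} (hρ : ρ.IsHermitian) :
    (dephase l ρ).IsHermitian := by
  have h : ∀ j : Fin N, (pauliZ j * ρ * pauliZ j)ᴴ = pauliZ j * ρ * pauliZ j := fun j => by
    rw [Matrix.conjTranspose_mul, Matrix.conjTranspose_mul, hρ.eq, (pauliZ_isHermitian j).eq,
      Matrix.mul_assoc]
  unfold Matrix.IsHermitian dephase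
  rw [Matrix.conjTranspose_add, Matrix.conjTranspose_smul, Matrix.conjTranspose_smul,
    Matrix.conjTranspose_sum, hρ.eq]
  simp [h]

/-- The quantum Fisher information, at any parameter value `χ`, of the family
`ρ_χ = exp(-iχH) ρ exp(iχH)` generated from the state `ρ` by `H`: with `ρ = ∑_a p_a |a⟩⟨a|` a
spectral decomposition,
`F = 2 ∑_{a,b : p_a + p_b ≠ 0} (p_a - p_b)² / (p_a + p_b) · |⟨a|H|b⟩|²`.
For a state `ρ`, the terms with `p_a + p_b = 0` vanish. -/
def qfi {N : ℕ} {ρ : Op N} (hρ : ρ.IsHermitian) (H : Op N) : ℝ :=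
  2 * ∑ a, ∑ b, (hρ.eigenvalues a - hρ.eigenvalues b) ^ 2 /
    (hρ.eigenvalues a + hρ.eigenvalues b) *
    ‖((hρ.eigenvectorUnitary : Op N)ᴴ * H * (hρ.eigenvectorUnitary : Op N)) a b‖ ^ 2

/-- The same number is `tr(ρ L²)` for every symmetric logarithmic derivative `L`, that is, every
Hermitian `L` with `∂ρ_χ = i(ρH - Hρ) = (ρL + Lρ)/2`. -/
theorem qfi_eq_trace_sld {N : ℕ} {ρ : Op N} (hρ : ρ.IsHermitian) (H L : Op N)
    (hL : L.IsHermitian)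
    (hsld : Complex.I • (ρ * H - H * ρ) = (1 / 2 : ℂ) • (ρ * L + L * ρ)) :
    (ρ * (L * L)).trace = (qfi hρ H : ℂ) := by
  set U : Op N := (hρ.eigenvectorUnitary : Op N) with hU
  set p := hρ.eigenvalues with hp
  have hUU : Uᴴ * U = 1 := Unitary.coe_star_mul_self hρ.eigenvectorUnitary
  have hUU' : U * Uᴴ = 1 := Unitary.coe_mul_star_self hρ.eigenvectorUnitary
  set D : Op N := Matrix.diagonal fun a => (p a : ℂ) with hD
  have hspec : ρ = U * D * Uᴴ := by
    have := hρ.spectral_theorem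
    rw [Unitary.conjStarAlgAut_apply] at this
    exact this
  set K : Op N := Uᴴ * H * U with hK
  set M : Op N := Uᴴ * L * U with hM
  have hMh : M.IsHermitian := Matrix.isHermitian_conjTranspose_mul_mul U hL
  have hLM : L = U * M * Uᴴ := by
    calc L = (U * Uᴴ) * L * (U * Uᴴ) := by rw [hUU']; simp
      _ = U * M * Uᴴ := by rw [hM]; simp only [Matrix.mul_assoc]
  have hρD : Uᴴ * ρ * U = D := by
    calc Uᴴ * ρ * U = (Uᴴ * U) * D * (Uᴴ * U) := by rw [hspec]; simp only [Matrix.mul_assoc]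
      _ = D := by rw [hUU]; simp
  have hconj : ∀ X Y : Op N, Uᴴ * (X * Y) * U = (Uᴴ * X * U) * (Uᴴ * Y * U) := fun X Y => by
    calc Uᴴ * (X * Y) * U = Uᴴ * X * 1 * Y * U := by simp only [Matrix.mul_assoc, Matrix.one_mul]
      _ = _ := by rw [← hUU']; simp only [Matrix.mul_assoc]
  have hdiag : Complex.I • (D * K - K * D) = (1 / 2 : ℂ) • (D * M + M * D) := by
    have := congrArg (fun X => Uᴴ * X * U) hsld
    simp only [Matrix.mul_smul, Matrix.smul_mul, Matrix.mul_sub, Matrix.sub_mul, Matrix.mul_add,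
      Matrix.add_mul, hconj, hρD] at this
    simpa [hK, hM] using this
  have hentry : ∀ a b, ((p a + p b : ℝ) : ℂ) * M a b = 2 * Complex.I * ((p a - p b : ℝ) : ℂ) * K a b := by
    intro a b
    have := congrFun (congrFun hdiag a) b
    simp [hD, Matrix.diagonal_mul, Matrix.mul_diagonal] at this
    push_cast
    linear_combination (-2) * this
  have hnorm : ∀ a b, (p a + p b) * ‖M a b‖ ^ 2
      = 4 * ((p a - p b) ^ 2 / (p a + p b) * ‖K a b‖ ^ 2) := by
    intro a b
    have h1 := congrArg (fun z : ℂ => ‖z‖ ^ 2) (hentry a b)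
    simp only [norm_mul, Complex.norm_real, Complex.norm_I, mul_pow, Real.norm_eq_abs, sq_abs] at h1
    norm_num at h1
    by_cases h0 : p a + p b = 0
    · simp [h0]
    · field_simp
      linarith
  have htr : (ρ * (L * L)).trace = ((∑ a, ∑ b, p a * ‖M a b‖ ^ 2 : ℝ) : ℂ) := by
    have h1 : ρ * (L * L) = U * (D * (M * M)) * Uᴴ := by
      calc ρ * (L * L) = U * D * (Uᴴ * U) * M * (Uᴴ * U) * M * Uᴴ := by
            rw [hLM]; nth_rw 1 [hspec]; simp only [Matrix.mul_assoc]
        _ = _ := by rw [hUU]; simp only [Matrix.mul_assoc, Matrix.one_mul]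
    rw [h1, Matrix.trace_mul_comm, ← Matrix.mul_assoc, hUU, Matrix.one_mul, Matrix.trace]
    push_cast
    refine Finset.sum_congr rfl fun a _ => ?_
    rw [Matrix.diag_apply, hD, Matrix.diagonal_mul, Matrix.mul_apply, Finset.mul_sum]
    refine Finset.sum_congr rfl fun b _ => ?_
    rw [← hMh.apply b a, ← Complex.mul_conj']
    rfl
  have hswap : ∑ a, ∑ b, p a * ‖M a b‖ ^ 2 = ∑ a, ∑ b, p b * ‖M a b‖ ^ 2 := by
    rw [Finset.sum_comm]
    refine Finset.sum_congr rfl fun a _ => Finset.sum_congr rfl fun b _ => ?_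
    rw [← hMh.apply b a, norm_star]
  have hhalf : ∑ a, ∑ b, p a * ‖M a b‖ ^ 2 = (1 / 2) * ∑ a, ∑ b, (p a + p b) * ‖M a b‖ ^ 2 := by
    simp only [add_mul, Finset.sum_add_distrib]
    linarith
  rw [htr, hhalf]
  simp only [hnorm, ← Finset.mul_sum]
  unfold qfi
  congr 1
  ring

end Metrology

end

namespace Metrology

open Matrix
open scoped ComplexOrder

/-! The Fisher information of a state is bounded below by the squared Hilbert-Schmidt norm of `[ρ,
H]` (`sum_norm_sq_commutator_le_qfi`), which needs no diagonalisation of `ρ`. In the computational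
basis `H` is diagonal and dephasing multiplies the entry at `(x, y)` by `dampingFactor l x y`, so
for a pure input this norm is an explicit double sum over bit strings.

The probe's probabilities depend only on the weight. By permutation symmetry, the average of the
damping factor over `x` of fixed weight, with `y` fixed, is `l + (1 - l) m(x) m(y)`, where `m` is
the mean spin; since the mean square is at least the square of the mean, `le_sum_dampingFactor_sq`
reduces the sum to mean spins alone. For the probe, `m` is distributed as `j / n` with `j` symmetric
binomial, so moments up to order four give exactly the stated bound (`sum_gnuProb_two_point`). It
holds for every `g ≥ 1`, not only asymptotically.

For GHZ at `l = 1/2` the damping factor between the two branches vanishes, so the output is diagonal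
and commutes with `H`. -/

/-! ### Dephasing and the generator in the computational basis. -/

/-- The eigenvalue `(-1)^{x_j}` of `Z_j` on `|x⟩`. -/
def spin {N : ℕ} (j : Fin N) (x : Bits N) : ℝ := (-1) ^ (x j : ℕ)

/-- The mean of the spins of `x`. -/
noncomputable def meanSpin {N : ℕ} (x : Bits N) : ℝ := (∑ j, spin j x) / N

/-- The dephasing channel multiplies the matrix entry at `(x, y)` by this number. -/
noncomputable def dampingFactor {N : ℕ} (l : ℝ) (x y : Bits N) : ℝ :=
  l + (1 - l) / N * ∑ j, spin j x * spin j y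

theorem spin_eq {N : ℕ} (j : Fin N) (x : Bits N) : spin j x = 1 - 2 * (x j : ℕ) := by
  unfold spin
  generalize x j = b
  fin_cases b <;> norm_num

theorem sum_spin {N : ℕ} (x : Bits N) : ∑ j, spin j x = N - 2 * weight x := by
  simp [spin_eq, weight, Finset.mul_sum]

theorem meanSpin_eq {N : ℕ} (hN : 0 < N) (x : Bits N) :
    meanSpin x = 1 - 2 * weight x / N := by
  have : (N : ℝ) ≠ 0 := by positivity
  rw [meanSpin, sum_spin]
  field_simp

theorem pauliZ_eq {N : ℕ} (j : Fin N) :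
    pauliZ j = Matrix.diagonal fun x : Bits N => ((spin j x : ℝ) : ℂ) := by
  simp [pauliZ, spin]

theorem generator_eq (N : ℕ) :
    generator N = Matrix.diagonal fun x : Bits N => ((∑ j, spin j x : ℝ) : ℂ) := by
  unfold generator
  ext x y
  rw [Matrix.sum_apply]
  by_cases h : x = y
  · subst h
    simp [pauliZ_eq]
  · simp [pauliZ_eq, h]

theorem dephase_apply {N : ℕ} (l : ℝ) (ρ : Op N) (x y : Bits N) :
    dephase l ρ x y = (dampingFactor l x y : ℂ) * ρ x y := by
  have h (j : Fin N) : (pauliZ j * ρ * pauliZ j) x y = (spin j x : ℂ) * spin j y * ρ x y := by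
    rw [pauliZ_eq, Matrix.mul_diagonal, Matrix.diagonal_mul]
    ring
  simp only [dephase, Matrix.add_apply, Matrix.smul_apply, Matrix.sum_apply, h, smul_eq_mul,
    dampingFactor, ← Finset.sum_mul]
  push_cast
  ring

/-! ### Fisher information and the commutator with the generator. -/

theorem sum_norm_sq_eq_trace {ι : Type*} [Fintype ι] (A : Matrix ι ι ℂ) :
    ((∑ a, ∑ b, ‖A a b‖ ^ 2 : ℝ) : ℂ) = (A * Aᴴ).trace := by
  simp only [Matrix.trace, Matrix.diag_apply, Matrix.mul_apply, Matrix.conjTranspose_apply]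
  push_cast
  refine Finset.sum_congr rfl fun a _ => Finset.sum_congr rfl fun b _ => ?_
  rw [← Complex.mul_conj']
  rfl

/-- In an eigenbasis of `ρ` the commutator has entries `(p_a - p_b) H_ab`. -/
theorem sq_mul_norm_sq_eq_commutator {N : ℕ} {ρ : Op N} (hρ : ρ.IsHermitian) (H : Op N)
    (a b : Bits N) :
    (hρ.eigenvalues a - hρ.eigenvalues b) ^ 2 *
      ‖((hρ.eigenvectorUnitary : Op N)ᴴ * H * (hρ.eigenvectorUnitary : Op N)) a b‖ ^ 2 =
    ‖((hρ.eigenvectorUnitary : Op N)ᴴ * (ρ * H - H * ρ) *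
      (hρ.eigenvectorUnitary : Op N)) a b‖ ^ 2 := by
  set U : Op N := (hρ.eigenvectorUnitary : Op N)
  set D : Op N := Matrix.diagonal fun a => (hρ.eigenvalues a : ℂ)
  have hUU : Uᴴ * U = 1 := Unitary.coe_star_mul_self hρ.eigenvectorUnitary
  have hspec : ρ = U * D * Uᴴ := by
    have := hρ.spectral_theorem
    rw [Unitary.conjStarAlgAut_apply] at this
    exact this
  have hl : Uᴴ * ρ = D * Uᴴ := by
    nth_rw 1 [hspec]
    rw [← Matrix.mul_assoc, ← Matrix.mul_assoc, hUU, Matrix.one_mul]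
  have hr : ρ * U = U * D := by
    nth_rw 1 [hspec]
    rw [Matrix.mul_assoc, hUU, Matrix.mul_one]
  have key : Uᴴ * (ρ * H - H * ρ) * U = D * (Uᴴ * H * U) - (Uᴴ * H * U) * D := by
    rw [Matrix.mul_sub, Matrix.sub_mul, ← Matrix.mul_assoc, hl]
    simp only [Matrix.mul_assoc, hr]
  rw [key, Matrix.sub_apply, Matrix.diagonal_mul, Matrix.mul_diagonal, mul_comm _ (_ : ℂ),
    ← mul_sub, norm_mul, ← Complex.ofReal_sub, Complex.norm_real, Real.norm_eq_abs, mul_pow,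
    sq_abs, mul_comm]

theorem qfi_eq_zero_of_commute {N : ℕ} {ρ : Op N} (hρ : ρ.IsHermitian) (H : Op N)
    (h : ρ * H = H * ρ) : qfi hρ H = 0 := by
  unfold qfi
  rw [Finset.sum_eq_zero, mul_zero]
  refine fun a _ => Finset.sum_eq_zero fun b _ => ?_
  rw [div_mul_eq_mul_div, sq_mul_norm_sq_eq_commutator, h]
  simp

/-- Unitary invariance of the Hilbert-Schmidt norm, moving from the computational basis to the
eigenbasis. -/
theorem sum_norm_sq_commutator {N : ℕ} {ρ : Op N} (hρ : ρ.IsHermitian) (H : Op N) :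
    ∑ x, ∑ y, ‖(ρ * H - H * ρ) x y‖ ^ 2 =
    ∑ a, ∑ b, (hρ.eigenvalues a - hρ.eigenvalues b) ^ 2 *
      ‖((hρ.eigenvectorUnitary : Op N)ᴴ * H * (hρ.eigenvectorUnitary : Op N)) a b‖ ^ 2 := by
  simp only [sq_mul_norm_sq_eq_commutator]
  set U : Op N := (hρ.eigenvectorUnitary : Op N)
  have hUU : U * Uᴴ = 1 := Unitary.coe_mul_star_self hρ.eigenvectorUnitary
  generalize ρ * H - H * ρ = C
  apply Complex.ofReal_injective
  rw [sum_norm_sq_eq_trace, sum_norm_sq_eq_trace]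
  have : Uᴴ * C * U * (Uᴴ * C * U)ᴴ = Uᴴ * (C * Cᴴ * U) := by
    calc _ = Uᴴ * C * (U * Uᴴ) * Cᴴ * U := by
          simp only [Matrix.conjTranspose_mul, Matrix.conjTranspose_conjTranspose, Matrix.mul_assoc]
      _ = _ := by rw [hUU]; simp only [Matrix.mul_assoc, Matrix.one_mul]
  rw [this, Matrix.trace_mul_comm Uᴴ, Matrix.mul_assoc, hUU, Matrix.mul_one]

/-- The quantum Fisher information of a state is at least the squared Hilbert-Schmidt norm of the
commutator with the generator. -/
theorem sum_norm_sq_commutator_le_qfi {N : ℕ} {ρ : Op N} (hρ : ρ.IsHermitian)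
    (hpos : ρ.PosSemidef) (htr : ρ.trace = 1) (H : Op N) :
    ∑ x, ∑ y, ‖(ρ * H - H * ρ) x y‖ ^ 2 ≤ qfi hρ H := by
  rw [sum_norm_sq_commutator hρ]
  have h0 (a) : 0 ≤ hρ.eigenvalues a := hpos.eigenvalues_nonneg a
  have hsum : ∑ a, hρ.eigenvalues a = 1 := by
    have := hρ.trace_eq_sum_eigenvalues
    rw [htr] at this
    exact Complex.ofReal_injective ((Complex.ofReal_sum _ _).trans this.symm)
  have h1 (a) : hρ.eigenvalues a ≤ 1 :=
    hsum ▸ Finset.single_le_sum (fun b _ => h0 b) (Finset.mem_univ a)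
  unfold qfi
  rw [Finset.mul_sum]
  refine Finset.sum_le_sum fun a _ => ?_
  rw [Finset.mul_sum]
  refine Finset.sum_le_sum fun b _ => ?_
  rw [← mul_assoc]
  refine mul_le_mul_of_nonneg_right ?_ (by positivity)
  -- If `p_a + p_b = 0`, both eigenvalues vanish and so do both sides; otherwise `p_a + p_b ≤ 2` is
  -- absorbed by the prefactor 2 of the Fisher information.
  rcases (add_nonneg (h0 a) (h0 b)).eq_or_lt' with h | h
  · have ha : hρ.eigenvalues a = 0 := by linarith [h0 a, h0 b]
    have hb : hρ.eigenvalues b = 0 := by linarith [h0 a, h0 b]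
    simp [ha, hb]
  · rw [← mul_div_assoc, le_div_iff₀ h]
    nlinarith [sq_nonneg (hρ.eigenvalues a - hρ.eigenvalues b), h1 a, h1 b]

/-! ### The dephased pure state. -/

theorem spin_mul_self {N : ℕ} (j : Fin N) (x : Bits N) : spin j x * spin j x = 1 := by
  rw [spin, ← mul_pow]
  norm_num

theorem trace_dephase_proj {N : ℕ} (hN : 0 < N) (l : ℝ) {ψ : Ket N}
    (hψ : ∑ x, ‖ψ x‖ ^ 2 = 1) : (dephase l (proj ψ)).trace = 1 := by
  have hN' : (N : ℝ) ≠ 0 := by positivity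
  have hd (x : Bits N) : dampingFactor l x x = 1 := by
    simp [dampingFactor, spin_mul_self, hN']
  simp only [Matrix.trace, Matrix.diag_apply, dephase_apply, hd, proj, Matrix.vecMulVec_apply,
    Pi.star_apply, RCLike.star_def, Complex.mul_conj',
    Complex.ofReal_one, one_mul]
  exact_mod_cast hψ

theorem dephase_posSemidef {N : ℕ} {l : ℝ} (h0 : 0 ≤ l) (h1 : l ≤ 1) {ρ : Op N}
    (hρ : ρ.PosSemidef) : (dephase l ρ).PosSemidef := by
  unfold dephase
  refine (hρ.smul (by exact_mod_cast h0)).add (Matrix.PosSemidef.smul ?_ ?_)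
  · refine Matrix.posSemidef_sum _ fun j _ => ?_
    nth_rw 2 [← (pauliZ_isHermitian j).eq]
    exact hρ.mul_mul_conjTranspose_same _
  · exact_mod_cast div_nonneg (sub_nonneg.2 h1) N.cast_nonneg

theorem norm_sq_commutator_dephase_proj {N : ℕ} (l : ℝ) (ψ : Ket N) (x y : Bits N) :
    ‖(dephase l (proj ψ) * generator N - generator N * dephase l (proj ψ)) x y‖ ^ 2 =
      ‖ψ x‖ ^ 2 * ‖ψ y‖ ^ 2 * dampingFactor l x y ^ 2 *
        (∑ j, spin j x - ∑ j, spin j y) ^ 2 := by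
  rw [generator_eq, Matrix.sub_apply, Matrix.mul_diagonal, Matrix.diagonal_mul, dephase_apply,
    mul_comm _ (Complex.ofReal (∑ j, spin j y)), ← sub_mul, ← Complex.ofReal_sub, proj,
    Matrix.vecMulVec_apply]
  simp only [norm_mul, Complex.norm_real, Real.norm_eq_abs, mul_pow, sq_abs, Pi.star_apply,
    norm_star]
  ring

/-! ### Averaging over strings of equal weight. -/

theorem weight_comp_perm {N : ℕ} (σ : Equiv.Perm (Fin N)) (x : Bits N) :
    weight (x ∘ σ) = weight x :=
  Equiv.sum_comp σ fun j => (x j : ℕ)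

theorem sum_weight_mul_spin_eq {N : ℕ} (f : ℕ → ℝ) (j k : Fin N) :
    ∑ x : Bits N, f (weight x) * spin j x = ∑ x : Bits N, f (weight x) * spin k x := by
  rw [← Equiv.sum_comp ((Equiv.swap j k).arrowCongr (Equiv.refl (Fin 2)))]
  refine Finset.sum_congr rfl fun x _ => ?_
  have : ((Equiv.swap j k).arrowCongr (Equiv.refl (Fin 2))) x = x ∘ Equiv.swap j k := by
    ext i
    simp
  rw [this, weight_comp_perm]
  simp [spin]

/-- Given the weight, all qubits are exchangeable, so the conditional mean of each spin is
`meanSpin`. -/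
theorem sum_weight_mul_spin_sub_meanSpin {N : ℕ} (f : ℕ → ℝ) (j : Fin N) :
    ∑ x : Bits N, f (weight x) * (spin j x - meanSpin x) = 0 := by
  have hN : (N : ℝ) ≠ 0 := by have := j.pos; positivity
  have h : ∑ x : Bits N, f (weight x) * meanSpin x =
      (∑ k : Fin N, ∑ x : Bits N, f (weight x) * spin k x) / N := by
    rw [Finset.sum_comm, Finset.sum_div]
    simp only [meanSpin, ← Finset.mul_sum, mul_div_assoc]
  simp only [mul_sub, Finset.sum_sub_distrib, h, sum_weight_mul_spin_eq f _ j]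
  simp [hN]

/-- The deviation is linear in the centred spins of `x`, so for fixed `y` it averages to zero
against any function of the weight of `x`. -/
theorem dampingFactor_sub {N : ℕ} (l : ℝ) (x y : Bits N) :
    dampingFactor l x y - (l + (1 - l) * (meanSpin x * meanSpin y)) =
      (1 - l) / N * ∑ j, spin j y * (spin j x - meanSpin x) := by
  simp only [dampingFactor, mul_sub, Finset.sum_sub_distrib, ← Finset.sum_mul]
  rw [meanSpin, meanSpin]
  simp only [mul_comm (spin _ y)]
  ring

/-- Symmetrization over states of equal weight can only decrease the second moment of the
damping factor. -/
theorem le_sum_dampingFactor_sq {N : ℕ} (l : ℝ) (p : ℕ → ℝ) (hp : ∀ w, 0 ≤ p w) :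
    ∑ x : Bits N, ∑ y : Bits N, p (weight x) * p (weight y) *
        (l + (1 - l) * (meanSpin x * meanSpin y)) ^ 2 * (meanSpin x - meanSpin y) ^ 2 ≤
      ∑ x : Bits N, ∑ y : Bits N, p (weight x) * p (weight y) *
        dampingFactor l x y ^ 2 * (meanSpin x - meanSpin y) ^ 2 := by
  rw [Finset.sum_comm, Finset.sum_comm (f := fun x y => p (weight x) * p (weight y) *
        dampingFactor l x y ^ 2 * (meanSpin x - meanSpin y) ^ 2)]
  refine Finset.sum_le_sum fun y _ => ?_
  set c : Bits N → ℝ := fun x => l + (1 - l) * (meanSpin x * meanSpin y) with hc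
  -- Orthogonality: for fixed `y`, `c` depends on `x` only through its weight, so the cross term
  -- vanishes.
  have hzero : ∑ x : Bits N, p (weight x) * p (weight y) * (meanSpin x - meanSpin y) ^ 2 *
      c x * (dampingFactor l x y - c x) = 0 := by
    simp only [hc, dampingFactor_sub, Finset.mul_sum]
    rw [Finset.sum_comm]
    refine Finset.sum_eq_zero fun j _ => ?_
    have hm (x : Bits N) : meanSpin x = (N - 2 * weight x : ℝ) / N := by
      rw [meanSpin, sum_spin]
    have := sum_weight_mul_spin_sub_meanSpin (fun w => p w * p (weight y) *
      ((N - 2 * w : ℝ) / N - meanSpin y) ^ 2 *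
      (l + (1 - l) * ((N - 2 * w : ℝ) / N * meanSpin y)) * ((1 - l) / N * spin j y)) j
    rw [← this]
    refine Finset.sum_congr rfl fun x _ => ?_
    simp only [hm x]
    ring
  -- This is `c² + 2c(d - c) ≤ d²` with nonnegative weights, `d` being the damping factor.
  have hle (x : Bits N) : p (weight x) * p (weight y) * c x ^ 2 *
        (meanSpin x - meanSpin y) ^ 2 + 2 * (p (weight x) * p (weight y) *
        (meanSpin x - meanSpin y) ^ 2 * c x * (dampingFactor l x y - c x)) ≤
      p (weight x) * p (weight y) * dampingFactor l x y ^ 2 * (meanSpin x - meanSpin y) ^ 2 := by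
    have := mul_nonneg (mul_nonneg (hp (weight x)) (hp (weight y)))
      (sq_nonneg ((dampingFactor l x y - c x) * (meanSpin x - meanSpin y)))
    linarith
  have := Finset.sum_le_sum fun x (_ : x ∈ Finset.univ) => hle x
  rw [Finset.sum_add_distrib, ← Finset.mul_sum, hzero] at this
  linarith

/-! ### Weight distribution of the gnu probe. -/

theorem weight_eq_card {N : ℕ} (x : Bits N) :
    weight x = (Finset.univ.filter fun j => x j = 1).card := by
  rw [Finset.card_filter]
  refine Finset.sum_congr rfl fun j _ => ?_
  generalize x j = b
  fin_cases b <;> simp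

theorem card_filter_weight_eq (N w : ℕ) :
    (Finset.univ.filter fun x : Bits N => weight x = w).card = N.choose w := by
  rw [← Finset.card_fin N, ← Finset.card_powersetCard w (Finset.univ : Finset (Fin N)),
    Finset.card_fin]
  refine Finset.card_nbij' (fun x => Finset.univ.filter fun j => x j = 1)
    (fun s j => if j ∈ s then 1 else 0) ?_ ?_ ?_ ?_
  · intro x hx
    simpa [Finset.mem_powersetCard, weight_eq_card] using hx
  · intro s hs
    simpa [Finset.mem_powersetCard, weight_eq_card] using hs
  · intro x _
    ext j
    have : ∀ b : Fin 2, ((if b = 1 then 1 else 0 : Fin 2) : ℕ) = b := by decide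
    simpa using this (x j)
  · intro s _
    ext j
    simp

theorem dicke_apply (N w : ℕ) (x : Bits N) :
    dicke N w x = if weight x = w then ((1 / √(N.choose w : ℝ) : ℝ) : ℂ) else 0 := by
  simp [dicke, basisKet, Pi.smul_apply, Finset.sum_apply, Pi.single_apply, Finset.sum_ite_eq]

/-- The probability of each basis state of weight `w` in the gnu probe state. -/
noncomputable def gnuProb (g n u w : ℕ) : ℝ :=
  ∑ j ∈ Finset.range (n + 1),
    if w = g * j then ((2 : ℝ) ^ n)⁻¹ * (n.choose j / (g * n * u).choose (g * j)) else 0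

theorem gnuProb_nonneg (g n u w : ℕ) : 0 ≤ gnuProb g n u w :=
  Finset.sum_nonneg fun j _ => by split_ifs <;> positivity

theorem norm_sq_gnuProbe {g : ℕ} (hg : 0 < g) (n u : ℕ) (x : Bits (g * n * u)) :
    ‖gnuProbe g n u x‖ ^ 2 = gnuProb g n u (weight x) := by
  simp only [gnuProbe, gnuProb, Pi.smul_apply, Finset.sum_apply, dicke_apply, smul_eq_mul]
  -- As `g > 0`, the Dicke components have disjoint supports, so at most one `j` contributes to each
  -- amplitude.
  by_cases h : ∃ j ∈ Finset.range (n + 1), weight x = g * j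
  · obtain ⟨j, hj, hx⟩ := h
    have hne {k : ℕ} (hk : k ≠ j) : ¬ weight x = g * k := by
      rw [hx, Nat.mul_right_inj hg.ne']
      exact hk.symm
    rw [Finset.sum_eq_single j (fun k _ hk => by simp [hne hk]) (absurd hj),
      Finset.sum_eq_single j (fun k _ hk => by simp [hne hk]) (absurd hj), if_pos hx, if_pos hx]
    simp only [norm_mul, Complex.norm_real, Real.norm_eq_abs, mul_pow, sq_abs, div_pow]
    rw [Real.sq_sqrt (by positivity), Real.sq_sqrt (by positivity), Real.sq_sqrt (by positivity)]
    ring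
  · push Not at h
    rw [Finset.sum_eq_zero fun j hj => by simp [h j hj],
      Finset.sum_eq_zero fun j hj => by simp [h j hj]]
    simp

/-- The number of strings of weight `g * j` cancels the Dicke normalisation, leaving a binomial law
in `j`. -/
theorem sum_gnuProb_mul {u : ℕ} (hu : 0 < u) (g n : ℕ) (f : ℕ → ℝ) :
    ∑ x : Bits (g * n * u), gnuProb g n u (weight x) * f (weight x) =
      ((2 : ℝ) ^ n)⁻¹ * ∑ j ∈ Finset.range (n + 1), n.choose j * f (g * j) := by
  simp only [gnuProb, Finset.sum_mul, Finset.mul_sum]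
  rw [Finset.sum_comm]
  refine Finset.sum_congr rfl fun j hj => ?_
  have hle : g * j ≤ g * n * u :=
    (Nat.mul_le_mul_left g (Finset.mem_range_succ_iff.1 hj)).trans (Nat.le_mul_of_pos_right _ hu)
  have hpos : ((g * n * u).choose (g * j) : ℝ) ≠ 0 := by
    exact_mod_cast (Nat.choose_pos hle).ne'
  have : ∀ x : Bits (g * n * u), (if weight x = g * j then
      ((2 : ℝ) ^ n)⁻¹ * (n.choose j / (g * n * u).choose (g * j)) else 0) * f (weight x) =
      if weight x = g * j then
      ((2 : ℝ) ^ n)⁻¹ * (n.choose j / (g * n * u).choose (g * j)) * f (g * j) else 0 := by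
    intro x
    split_ifs with h
    · rw [h]
    · simp
  simp only [this]
  rw [← Finset.sum_filter, Finset.sum_const, card_filter_weight_eq, nsmul_eq_mul]
  field_simp

/-! ### Moments of the symmetric binomial distribution. -/

/-- The expectation of `f` under the symmetric binomial distribution. -/
noncomputable def binomMean (n : ℕ) (f : ℕ → ℝ) : ℝ :=
  ((2 : ℝ) ^ n)⁻¹ * ∑ j ∈ Finset.range (n + 1), n.choose j * f j

/-- Conditioning on one coin toss (Pascal's rule); it drives the induction for every moment. -/
theorem binomMean_succ (n : ℕ) (f : ℕ → ℝ) :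
    binomMean (n + 1) f = (binomMean n f + binomMean n fun j => f (j + 1)) / 2 := by
  have := Finset.sum_choose_succ_mul (fun j _ => f j) n
  rw [binomMean, this, binomMean, binomMean, pow_succ]
  ring

theorem binomMean_add (n : ℕ) (f h : ℕ → ℝ) :
    binomMean n (fun j => f j + h j) = binomMean n f + binomMean n h := by
  simp [binomMean, mul_add, Finset.sum_add_distrib]

theorem binomMean_const_mul (n : ℕ) (c : ℝ) (f : ℕ → ℝ) :
    binomMean n (fun j => c * f j) = c * binomMean n f := by
  simp only [binomMean, Finset.mul_sum]
  exact Finset.sum_congr rfl fun j _ => by ring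

theorem binomMean_one (n : ℕ) : binomMean n (fun _ => 1) = 1 := by
  induction n with
  | zero => simp [binomMean]
  | succ n ih => rw [binomMean_succ, ih]; norm_num

theorem binomMean_id (n : ℕ) : binomMean n (fun j => (j : ℝ)) = n / 2 := by
  induction n with
  | zero => simp [binomMean]
  | succ n ih =>
    rw [binomMean_succ]
    push_cast
    rw [binomMean_add, ih, binomMean_one]
    ring

theorem binomMean_sq (n : ℕ) : binomMean n (fun j => (j : ℝ) ^ 2) = n * (n + 1) / 4 := by
  induction n with
  | zero => simp [binomMean]
  | succ n ih =>
    have : (fun j : ℕ => ((j + 1 : ℕ) : ℝ) ^ 2) = fun j : ℕ => ((j : ℝ) ^ 2 + (2 * j + 1)) := by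
      funext j; push_cast; ring
    rw [binomMean_succ, this]
    simp only [binomMean_add, binomMean_const_mul, ih, binomMean_id, binomMean_one]
    push_cast
    ring

theorem binomMean_cube (n : ℕ) : binomMean n (fun j => (j : ℝ) ^ 3) = n ^ 2 * (n + 3) / 8 := by
  induction n with
  | zero => simp [binomMean]
  | succ n ih =>
    have : (fun j : ℕ => ((j + 1 : ℕ) : ℝ) ^ 3) =
        fun j : ℕ => ((j : ℝ) ^ 3 + (3 * (j : ℝ) ^ 2 + (3 * j + 1))) := by
      funext j; push_cast; ring
    rw [binomMean_succ, this]
    simp only [binomMean_add, binomMean_const_mul, ih, binomMean_sq, binomMean_id, binomMean_one]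
    push_cast
    ring

theorem binomMean_fourth (n : ℕ) :
    binomMean n (fun j => (j : ℝ) ^ 4) = n * (n + 1) * (n ^ 2 + 5 * n - 2) / 16 := by
  induction n with
  | zero => simp [binomMean]
  | succ n ih =>
    have : (fun j : ℕ => ((j + 1 : ℕ) : ℝ) ^ 4) = fun j : ℕ =>
        ((j : ℝ) ^ 4 + (4 * (j : ℝ) ^ 3 + (6 * (j : ℝ) ^ 2 + (4 * j + 1)))) := by
      funext j; push_cast; ring
    rw [binomMean_succ, this]
    simp only [binomMean_add, binomMean_const_mul, ih, binomMean_cube, binomMean_sq, binomMean_id,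
      binomMean_one]
    push_cast
    ring

/-! ### The lower bound for the probe. -/

theorem sum_gnuProb_mul_meanSpin_pow {g n : ℕ} (hg : 0 < g) (hn : 0 < n) (k : ℕ) :
    ∑ x : Bits (g * n * 2), gnuProb g n 2 (weight x) * meanSpin x ^ k =
      binomMean n (fun j => (j : ℝ) ^ k) / n ^ k := by
  have hg' : (g : ℝ) ≠ 0 := by positivity
  have hn' : (n : ℝ) ≠ 0 := by positivity
  simp only [meanSpin_eq (show 0 < g * n * 2 by positivity)]
  rw [sum_gnuProb_mul two_pos g n fun w => (1 - 2 * (w : ℝ) / ((g * n * 2 : ℕ) : ℝ)) ^ k,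
    -- Weight `g * j` has mean spin `1 - j / n`; the reflection `j ↦ n - j` preserves the binomial
    -- law and turns this into `j / n`.
    ← Finset.sum_range_reflect, binomMean, mul_div_assoc, Finset.sum_div]
  congr 1
  refine Finset.sum_congr rfl fun j hj => ?_
  have hj' : j ≤ n := Finset.mem_range_succ_iff.1 hj
  rw [show n + 1 - 1 - j = n - j by omega, Nat.choose_symm hj', mul_div_assoc (n.choose j : ℝ), ← div_pow]
  congr 2
  push_cast [Nat.cast_sub hj']
  field_simp
  ring

theorem sum_gnuProb {g n : ℕ} (hg : 0 < g) (hn : 0 < n) :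
    ∑ x : Bits (g * n * 2), gnuProb g n 2 (weight x) = 1 := by
  have := sum_gnuProb_mul_meanSpin_pow hg hn 0
  simpa [binomMean_one] using this

theorem sum_gnuProb_two_point {g n : ℕ} (hg : 0 < g) (hn : 0 < n) (l : ℝ) :
    ∑ x : Bits (g * n * 2), ∑ y : Bits (g * n * 2),
        gnuProb g n 2 (weight x) * gnuProb g n 2 (weight y) *
        (l + (1 - l) * (meanSpin x * meanSpin y)) ^ 2 * (meanSpin x - meanSpin y) ^ 2 =
      l ^ 2 / (2 * (n : ℝ)) + l * (1 - l) * (((n : ℝ) - 1) / (4 * (n : ℝ) ^ 2))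
          + (1 - l) ^ 2 * (((n : ℝ) ^ 3 + (n : ℝ) - 2) / (32 * (n : ℝ) ^ 4)) := by
  have hn' : (n : ℝ) ≠ 0 := by positivity
  have m (k : ℕ) := sum_gnuProb_mul_meanSpin_pow hg hn k
  have key (c : ℝ) (i k : ℕ) : ∑ x : Bits (g * n * 2), ∑ y : Bits (g * n * 2),
      c * ((gnuProb g n 2 (weight x) * meanSpin x ^ i) *
        (gnuProb g n 2 (weight y) * meanSpin y ^ k)) =
      c * ((binomMean n (fun j => (j : ℝ) ^ i) / n ^ i) *
        (binomMean n (fun j => (j : ℝ) ^ k) / n ^ k)) := by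
    simp_rw [← Finset.mul_sum]
    rw [← Finset.sum_mul, m, m]
  -- Expanding into monomials separates `x` from `y`, so each double sum becomes a product of two
  -- moments.
  calc _ = ∑ x : Bits (g * n * 2), ∑ y : Bits (g * n * 2), (
        l ^ 2 * ((gnuProb g n 2 (weight x) * meanSpin x ^ 2) *
          (gnuProb g n 2 (weight y) * meanSpin y ^ 0))
        + l ^ 2 * ((gnuProb g n 2 (weight x) * meanSpin x ^ 0) *
          (gnuProb g n 2 (weight y) * meanSpin y ^ 2))
        + (-2 * l ^ 2) * ((gnuProb g n 2 (weight x) * meanSpin x ^ 1) *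
          (gnuProb g n 2 (weight y) * meanSpin y ^ 1))
        + 2 * l * (1 - l) * ((gnuProb g n 2 (weight x) * meanSpin x ^ 3) *
          (gnuProb g n 2 (weight y) * meanSpin y ^ 1))
        + 2 * l * (1 - l) * ((gnuProb g n 2 (weight x) * meanSpin x ^ 1) *
          (gnuProb g n 2 (weight y) * meanSpin y ^ 3))
        + (-4 * l * (1 - l)) * ((gnuProb g n 2 (weight x) * meanSpin x ^ 2) *
          (gnuProb g n 2 (weight y) * meanSpin y ^ 2))
        + (1 - l) ^ 2 * ((gnuProb g n 2 (weight x) * meanSpin x ^ 4) *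
          (gnuProb g n 2 (weight y) * meanSpin y ^ 2))
        + (1 - l) ^ 2 * ((gnuProb g n 2 (weight x) * meanSpin x ^ 2) *
          (gnuProb g n 2 (weight y) * meanSpin y ^ 4))
        + (-2 * (1 - l) ^ 2) * ((gnuProb g n 2 (weight x) * meanSpin x ^ 3) *
          (gnuProb g n 2 (weight y) * meanSpin y ^ 3))) :=
        Finset.sum_congr rfl fun x _ => Finset.sum_congr rfl fun y _ => by ring
    _ = _ := by
      simp only [Finset.sum_add_distrib, key]
      simp only [pow_zero, pow_one, binomMean_one, binomMean_id, binomMean_sq, binomMean_cube,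
        binomMean_fourth]
      field_simp
      ring

theorem le_qfi_dephase_gnuProbe {g n : ℕ} (hg : 0 < g) (hn : 0 < n) {l : ℝ} (h0 : 0 ≤ l)
    (h1 : l ≤ 1) :
    l ^ 2 / (2 * (n : ℝ)) + l * (1 - l) * (((n : ℝ) - 1) / (4 * (n : ℝ) ^ 2))
          + (1 - l) ^ 2 * (((n : ℝ) ^ 3 + (n : ℝ) - 2) / (32 * (n : ℝ) ^ 4))
        ≤ qfi (dephase_isHermitian l (proj_isHermitian (gnuProbe g n 2)))
            (generator (g * n * 2)) / ((g * n * 2 : ℕ) : ℝ) ^ 2 := by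
  have hN : 0 < g * n * 2 := by positivity
  have hN' : (0 : ℝ) < ((g * n * 2 : ℕ) : ℝ) := by exact_mod_cast hN
  have hpos : (dephase l (proj (gnuProbe g n 2))).PosSemidef :=
    dephase_posSemidef h0 h1 (Matrix.posSemidef_vecMulVec_self_star _)
  have htr : (dephase l (proj (gnuProbe g n 2))).trace = 1 :=
    trace_dephase_proj hN l (by simp only [norm_sq_gnuProbe hg]; exact sum_gnuProb hg hn)
  have hF := sum_norm_sq_commutator_le_qfi
    (dephase_isHermitian l (proj_isHermitian (gnuProbe g n 2))) hpos htr (generator (g * n * 2))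
  rw [← sum_gnuProb_two_point hg hn]
  refine (le_sum_dampingFactor_sq l _ (gnuProb_nonneg g n 2)).trans ?_
  rw [le_div_iff₀ (by positivity)]
  refine le_trans (le_of_eq ?_) hF
  rw [Finset.sum_mul]
  refine Finset.sum_congr rfl fun x _ => ?_
  rw [Finset.sum_mul]
  refine Finset.sum_congr rfl fun y _ => ?_
  rw [norm_sq_commutator_dephase_proj, norm_sq_gnuProbe hg, norm_sq_gnuProbe hg, meanSpin,
    meanSpin]
  field_simp

/-! ### The GHZ state. -/

theorem dephase_half_proj_ghz {N : ℕ} (hN : 0 < N) :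
    dephase (1 / 2) (proj (ghz N)) =
      (1 / 2 : ℂ) • (proj (basisKet fun _ => 0) + proj (basisKet fun _ => 1)) := by
  have hN' : (N : ℝ) ≠ 0 := by positivity
  have hne : (fun _ : Fin N => (0 : Fin 2)) ≠ fun _ => 1 := fun h => by
    simpa using congrFun h ⟨0, hN⟩
  have h2 : ((√2 : ℝ) : ℂ)⁻¹ * ((√2 : ℝ) : ℂ)⁻¹ = 1 / 2 := by
    rw [← mul_inv, ← Complex.ofReal_mul, Real.mul_self_sqrt zero_le_two]
    norm_num
  have h00 : dampingFactor (1 / 2) (fun _ : Fin N => (0 : Fin 2)) (fun _ => 0) = 1 := by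
    simp [dampingFactor, spin, hN']
  have h11 : dampingFactor (1 / 2) (fun _ : Fin N => (1 : Fin 2)) (fun _ => 1) = 1 := by
    simp [dampingFactor, spin, hN']
  -- All `N` spin products equal `-1`, giving `1/2 - 1/2`.
  have h01 : dampingFactor (1 / 2) (fun _ : Fin N => (0 : Fin 2)) (fun _ => 1) = 0 := by
    simp [dampingFactor, spin, hN']; norm_num
  have h10 : dampingFactor (1 / 2) (fun _ : Fin N => (1 : Fin 2)) (fun _ => 0) = 0 := by
    simp [dampingFactor, spin, hN']; norm_num
  ext x y
  rw [dephase_apply]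
  simp only [proj, ghz, basisKet, Matrix.vecMulVec_apply, Matrix.smul_apply, Matrix.add_apply,
    Pi.smul_apply, Pi.add_apply, Pi.star_apply, Pi.single_apply, smul_eq_mul]
  by_cases hx0 : x = fun _ => 0
  · by_cases hy0 : y = fun _ => 0
    · subst hx0 hy0
      rw [h00]
      simp [hne, h2]
    · by_cases hy1 : y = fun _ => 1
      · subst hx0 hy1
        rw [h01]
        simp [hne, hne.symm]
      · simp [hx0, hy0, hy1, hne]
  · by_cases hx1 : x = fun _ => 1
    · by_cases hy0 : y = fun _ => 0
      · subst hx1 hy0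
        rw [h10]
        simp [hne, hne.symm]
      · by_cases hy1 : y = fun _ => 1
        · subst hx1 hy1
          rw [h11]
          simp [hne.symm, h2]
        · simp [hx1, hy0, hy1]
    · simp [hx0, hx1]

theorem proj_basisKet {N : ℕ} (z : Bits N) :
    proj (basisKet z) = Matrix.diagonal (Pi.single z 1) := by
  ext x y
  simp only [proj, basisKet, Matrix.vecMulVec_apply, Pi.star_apply, Matrix.diagonal_apply,
    Pi.single_apply]
  by_cases hx : x = z <;> by_cases hy : y = z <;> simp_all [eq_comm]

theorem qfi_dephase_half_ghz {N : ℕ} (hN : 0 < N) :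
    qfi (dephase_isHermitian (1 / 2) (proj_isHermitian (ghz N))) (generator N) = 0 := by
  apply qfi_eq_zero_of_commute
  rw [dephase_half_proj_ghz hN, proj_basisKet, proj_basisKet, generator_eq, Matrix.diagonal_add,
    Matrix.smul_mul, Matrix.mul_smul, Matrix.diagonal_mul_diagonal, Matrix.diagonal_mul_diagonal]
  simp only [mul_comm]

end Metrology

open Metrology Filter in
theorem mainTheorem5 :
    (∀ n : ℕ, 1 ≤ n → ∀ l : ℝ, 0 ≤ l → l ≤ 1 → ∀ᶠ g : ℕ in atTop,
      l ^ 2 / (2 * (n : ℝ)) + l * (1 - l) * (((n : ℝ) - 1) / (4 * (n : ℝ) ^ 2))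
          + (1 - l) ^ 2 * (((n : ℝ) ^ 3 + (n : ℝ) - 2) / (32 * (n : ℝ) ^ 4))
        ≤ qfi (dephase_isHermitian l (proj_isHermitian (gnuProbe g n 2)))
            (generator (g * n * 2)) / ((g * n * 2 : ℕ) : ℝ) ^ 2) ∧
    (∀ n : ℕ, 1 ≤ n → ∃ c : ℝ, 0 < c ∧
      c = 25 / (128 * (n : ℝ)) - 1 / (16 * (n : ℝ) ^ 2) + 1 / (128 * (n : ℝ) ^ 3)
          - 1 / (64 * (n : ℝ) ^ 4) ∧
      ∀ᶠ g : ℕ in atTop,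
        c * ((g * n * 2 : ℕ) : ℝ) ^ 2
          ≤ qfi (dephase_isHermitian (1 / 2) (proj_isHermitian (gnuProbe g n 2)))
              (generator (g * n * 2))) ∧
    (∀ N : ℕ, 1 ≤ N →
      dephase (1 / 2) (proj (ghz N))
          = (1 / 2 : ℂ) • (proj (basisKet fun _ => 0) + proj (basisKet fun _ => 1)) ∧
      qfi (dephase_isHermitian (1 / 2) (proj_isHermitian (ghz N))) (generator N) = 0) := by
  refine ⟨fun n hn l h0 h1 => ?_, fun n hn => ⟨_, ?_, rfl, ?_⟩, fun N hN =>
    ⟨dephase_half_proj_ghz hN, qfi_dephase_half_ghz hN⟩⟩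
  · filter_upwards [eventually_gt_atTop 0] with g hg
    exact le_qfi_dephase_gnuProbe hg hn h0 h1
  · have hn' : (1 : ℝ) ≤ n := by exact_mod_cast hn
    have h : (25 : ℝ) / (128 * n) - 1 / (16 * n ^ 2) + 1 / (128 * n ^ 3) - 1 / (64 * n ^ 4) =
        (25 * n ^ 3 - 8 * n ^ 2 + n - 2) / (128 * n ^ 4) := by
      field_simp
      ring
    rw [h]
    apply div_pos _ (by positivity)
    -- From `n³ ≥ n²`, the numerator is at least `17 n² + n - 2 > 0`.
    nlinarith [mul_nonneg (sq_nonneg (n : ℝ)) (sub_nonneg.2 hn'), sq_nonneg (n : ℝ)]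
  · filter_upwards [eventually_gt_atTop 0] with g hg
    have hN : (0 : ℝ) < ((g * n * 2 : ℕ) : ℝ) := by
      exact_mod_cast Nat.mul_pos (Nat.mul_pos hg hn) two_pos
    have hn' : (n : ℝ) ≠ 0 := by positivity
    rw [← le_div_iff₀ (by positivity)]
    refine le_trans (le_of_eq ?_) (le_qfi_dephase_gnuProbe hg hn (by norm_num) (by norm_num))
    field_simp
    ring
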